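/- Let $\mathbb{D}=\{z\in\mathbb{C}:|z|<1\}$. For $-1/2\le\alpha<0$ let $\mathcal{F}(\alpha)$ be the class of functions $f$ analytic in $\mathbb{D}$ with $f(0)=0$, $f'(0)=1$, $f'\neq 0$ in $\mathbb{D}$ and $$\operatorname{Re}\left(1+\frac{zf''(z)}{f'(z)}\right)>\alpha\qquad(z\in\mathbb{D}).$$ For $z_1,z_2\in\mathbb{D}$ let $$\rho(z_1,z_2)=\left|\frac{z_1-z_2}{1-\overline{z_1}z_2}\right|,\qquad \lambda(z_1,z_2)=\frac12\log\frac{1+\rho(z_1,z_2)}{1-\rho(z_1,z_2)},$$ and $$\Delta_f(z_1,z_2)=\frac{|f(z_1)-f(z_2)|}{\sqrt{(1-|z_1|^2)|f'(z_1)|\,(1-|z_2|^2)|f'(z_2)|}}.$$ Let $-1/2\le\alpha<0$. Then for every $f\in\mathcal{F}(\alpha)$ $$\Delta_f(z_1,z_2)\ge\sqrt{\frac{1+\alpha}{-2\alpha}}\,\sin\left(\sqrt{\frac{-2\alpha}{1+\alpha}}\;\lambda(z_1,z_2)\right)$$ for all $z_1,z_2\in\mathbb{D}$ with $\lambda(z_1,z_2)\le\pi\sqrt{(1+\alpha)/(-2\alpha)}$,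 and $$\Delta_f(z_1,z_2)\le\sqrt{\frac{1+\alpha}{2}}\,\sinh\left(\sqrt{\frac{2}{1+\alpha}}\;\lambda(z_1,z_2)\right)$$ for all $z_1,z_2\in\mathbb{D}$. Both inequalities are sharp, in the sense that their constants are best possible for the class $\mathcal{F}(\alpha)$, even for pairs of points that are arbitrarily close: for every $0<\delta<\sqrt{-2\alpha/(1+\alpha)}$ and every $\varepsilon>0$ there are $f\in\mathcal{F}(\alpha)$ and $z_1,z_2\in\mathbb{D}$ with $\lambda(z_1,z_2)<\varepsilon$ and $$\Delta_f(z_1,z_2)<\frac1\delta\sin\bigl(\delta\lambda(z_1,z_2)\bigr),$$ and for every $0<\kappa<\sqrt{2/(1+\alpha)}$ and every $\varepsilon>0$ there are $f\in\mathcal{F}(\alpha)$ and $z_1,z_2\in\mathbb{D}$ with $\lambda(z_1,z_2)<\varepsilon$ and $$\Delta_f(z_1,z_2)>\frac1\kappa\sinh\bigl(\kappa\lambda(z_1,z_2)\bigr).$$ -/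

import Mathlib

open scoped ComplexConjugate

noncomputable section

/-- The open unit disk of the complex plane. -/
def unitDisk : Set ℂ := Metric.ball (0 : ℂ) 1

/-- The class of functions analytic in the unit disk, normalized by `f 0 = 0`, `f' 0 = 1`. -/
def classA : Set (ℂ → ℂ) :=
  {f | DifferentiableOn ℂ f unitDisk ∧ f 0 = 0 ∧ deriv f 0 = 1}

/-- The class of those normalized analytic functions, with nowhere vanishing derivative, that satisfy
`Re (1 + z f'' z / f' z) > α` throughout the unit disk. -/
def classF (α : ℝ) : Set (ℂ → ℂ) :=
  {f | f ∈ classA ∧ (∀ z ∈ unitDisk, deriv f z ≠ 0) ∧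
    ∀ z ∈ unitDisk, α < (1 + z * deriv (deriv f) z / deriv f z).re}

/-- The pseudo-hyperbolic distance. -/
def pseudoHypDist (z₁ z₂ : ℂ) : ℝ := ‖(z₁ - z₂) / (1 - conj z₁ * z₂)‖

/-- The hyperbolic distance of the unit disk, for the metric `|dz| / (1 - |z|²)`. -/
def hypDist (z₁ z₂ : ℂ) : ℝ :=
  1 / 2 * Real.log ((1 + pseudoHypDist z₁ z₂) / (1 - pseudoHypDist z₁ z₂))

/-- The two-point distortion quantity
`|f z₁ - f z₂| / √((1 - |z₁|²)|f' z₁| (1 - |z₂|²)|f' z₂|)`. -/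
def twoPointDistortion (f : ℂ → ℂ) (z₁ z₂ : ℂ) : ℝ :=
  ‖f z₁ - f z₂‖ /
    √(((1 - ‖z₁‖ ^ 2) * ‖deriv f z₁‖) * ((1 - ‖z₂‖ ^ 2) * ‖deriv f z₂‖))

end

open Set Filter Topology

/-! Along a hyperbolic geodesic γ from z₁, parametrized by arc length t, Δ_f(z₁, γ(t)) equals
|v(t)|/|v'(0)|, where v(0) = 0 and v'' = (1 - q) v with q = (S_f/2)(γ) · γ'²
(`exists_solution_twoPointDistortion`). This is the classical fact that (f - f(z₁))/√f' solves V'' =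
-(S_f/2) V, rewritten in the variable t; the 1 is the contribution of the hyperbolic metric. Since
|γ'| = 1 - |γ|², bounding q means bounding (1 - |z|²)²|S_f|.

On the class F(α) this quantity is at most 2(1 - α)/(1 + α) (`norm_schwarzian_le`). The half-plane
condition on zf''/f' is encoded by an analytic φ with |φ| ≤ 1, S_f becomes an expression in φ and
φ', and the Schwarz–Pick lemma reduces the bound to a real inequality. Hence |q| ≤ (1 - α)/(1 + α),
so that |1 - q| ≤ 2/(1 + α) and Re(1 - q) ≥ 2α/(1 + α). The first estimate gives the sinh bound by a
Grönwall-type iteration (`norm_le_sinh_of_norm_coeff_le`), the second the sine bound by Sturm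
comparison for complex solutions (`sturm_norm_ge`). Both bounds need only -1 < α < 0.

For sharpness, explicit functions make q(0) as close as desired to ±(1 - α)/(1 + α), the sign
depending on the direction of the geodesic (`exists_schwarzian_near_extremal`); this is where α ≥
-1/2 enters. The expansion |v(t)|/|v'(0)| = t + c(0)t³/6 + o(t³), for real c(0), then decides the
comparison at arbitrarily small distances. -/

/-! ### Comparison theorems for complex solutions of v'' = c v. -/

/-- A solution of `v'' = c v` with `v 0 = 0` and `|c| ≤ κ²` grows at most like `sinh (κ t) / κ`. -/
theorem norm_le_sinh_of_norm_coeff_le {v v' c : ℝ → ℂ} {κ : ℝ} (hκ : 0 < κ)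
    (hv : ∀ t, HasDerivAt v (v' t) t) (hv' : ∀ t, HasDerivAt v' (c t * v t) t)
    (h0 : v 0 = 0) (hc : ∀ t, ‖c t‖ ≤ κ ^ 2) {L : ℝ} (hL : 0 ≤ L) :
    ‖v L‖ ≤ ‖v' 0‖ * (Real.sinh (κ * L) / κ) := by
  have hvc : Continuous v := continuous_iff_continuousAt.2 fun t => (hv t).continuousAt
  have hvc' : Continuous v' := continuous_iff_continuousAt.2 fun t => (hv' t).continuousAt
  obtain ⟨C, hC⟩ := isCompact_Icc.exists_bound_of_continuousOn (hvc.continuousOn (s := Icc 0 L))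
  have hpow : ∀ n : ℕ, ∀ t : ℝ, HasDerivAt
      (fun t : ℝ => (κ * t) ^ (n + 1) / (n + 1).factorial)
      (κ * ((κ * t) ^ n / n.factorial)) t := by
    intro n t
    have h1 : HasDerivAt (fun t : ℝ => κ * t) κ t := by simpa using (hasDerivAt_id t).const_mul κ
    refine ((h1.fun_pow (n + 1)).div_const ((n + 1).factorial : ℝ)).congr_deriv ?_
    have : (n.factorial : ℝ) ≠ 0 := by positivity
    rw [Nat.factorial_succ]
    push_cast
    field_simp
  have hlin : ∀ t : ℝ, HasDerivAt (fun t : ℝ => κ * t) κ t := fun t => by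
    simpa using (hasDerivAt_id t).const_mul κ
  -- Bootstrap: the sinh term reproduces itself under two integrations of the equation, while the
  -- remainder, at first the crude bound `C`, gains two orders in t each time and tends to 0.
  have key : ∀ n : ℕ, ∀ t ∈ Icc 0 L,
      ‖v t‖ ≤ ‖v' 0‖ * (Real.sinh (κ * t) / κ) + C * ((κ * t) ^ (2 * n) / (2 * n).factorial) := by
    intro n
    induction n with
    | zero =>
      intro t ht
      have : 0 ≤ ‖v' 0‖ * (Real.sinh (κ * t) / κ) := by
        have := Real.sinh_nonneg_iff.2 (mul_nonneg hκ.le ht.1)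
        positivity
      simpa using (hC t ht).trans (by linarith)
    | succ n ih =>
      have h1 : ∀ t ∈ Icc 0 L, ‖v' t‖ ≤ ‖v' 0‖ * Real.cosh (κ * t)
          + C * κ * ((κ * t) ^ (2 * n + 1) / (2 * n + 1).factorial) := by
        refine image_norm_le_of_norm_deriv_right_le_deriv_boundary hvc'.continuousOn
          (fun x _ => (hv' x).hasDerivWithinAt) (B' := fun t => ‖v' 0‖ * (Real.sinh (κ * t) * κ)
            + C * κ * (κ * ((κ * t) ^ (2 * n) / (2 * n).factorial))) (by simp)
          (fun x => (((hlin x).cosh).const_mul _).add ((hpow (2 * n) x).const_mul _)) ?_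
        intro x hx
        rw [norm_mul]
        refine (mul_le_mul (hc x) (ih x ⟨hx.1, hx.2.le⟩) (norm_nonneg _) (by positivity)).trans_eq ?_
        field_simp
      refine image_norm_le_of_norm_deriv_right_le_deriv_boundary hvc.continuousOn
          (fun x _ => (hv x).hasDerivWithinAt) (B' := fun t => ‖v' 0‖ * (Real.cosh (κ * t) * κ / κ)
            + C * (κ * ((κ * t) ^ (2 * n + 1) / (2 * n + 1).factorial))) (by simp [h0])
          (fun x => ((((hlin x).sinh).div_const κ).const_mul _).add
            ((hpow (2 * n + 1) x).const_mul _)) ?_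
      intro x hx
      refine (h1 x ⟨hx.1, hx.2.le⟩).trans_eq ?_
      field_simp
  have hlim : Tendsto (fun n : ℕ => ‖v' 0‖ * (Real.sinh (κ * L) / κ)
      + C * ((κ * L) ^ (2 * n) / (2 * n).factorial)) atTop
      (𝓝 (‖v' 0‖ * (Real.sinh (κ * L) / κ) + C * 0)) :=
    (((FloorSemiring.tendsto_pow_div_factorial_atTop (κ * L)).comp
      (tendsto_id.const_mul_atTop' (by norm_num : 0 < 2))).const_mul C).const_add _
  rw [mul_zero, add_zero] at hlim
  exact ge_of_tendsto' hlim fun n => key n L ⟨hL, le_rfl⟩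

/-- The quotient by `t` of a function vanishing at `0` tends to its derivative there. -/
theorem tendsto_div_nhdsGT_of_hasDerivAt {v : ℝ → ℂ} {w : ℂ} (hv : HasDerivAt v w 0) (h0 : v 0 = 0) :
    Tendsto (fun t : ℝ => v t / (t : ℂ)) (𝓝[>] 0) (𝓝 w) := by
  have := (hasDerivAt_iff_tendsto_slope_zero.1 hv).mono_left
    (nhdsWithin_mono 0 (fun x hx => ne_of_gt hx : Ioi (0 : ℝ) ⊆ {0}ᶜ))
  refine this.congr fun t => ?_
  simp [h0, div_eq_inv_mul]

/-- Sturm comparison for complex solutions: if `v'' = c v`, `s'' = k s` with `k ≤ Re c`, both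
vanishing at `0`, then `|v|` dominates `s` as long as `s` is positive. -/
theorem sturm_norm_ge {v v' c : ℝ → ℂ} {s s' : ℝ → ℝ} {k : ℝ}
    (hv : ∀ t, HasDerivAt v (v' t) t) (hv' : ∀ t, HasDerivAt v' (c t * v t) t) (h0 : v 0 = 0)
    (hs : ∀ t, HasDerivAt s (s' t) t) (hs' : ∀ t, HasDerivAt s' (k * s t) t) (hs0 : s 0 = 0)
    (hs1 : s' 0 = 1) (hc : ∀ t, k ≤ (c t).re) {L : ℝ} (hL : 0 < L)
    (hpos : ∀ t ∈ Ioc 0 L, 0 < s t) :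
    ‖v' 0‖ * s L ≤ ‖v L‖ := by
  set g : ℝ → ℂ := fun t => v t / (s t : ℂ) with hg
  -- `W` is the Wronskian: g' = W/s² and W' = (c - k) s v. The aim is that |g| increases from its
  -- limit |v'(0)|.
  set W : ℝ → ℂ := fun t => s t * v' t - s' t * v t with hW
  have hsC : ∀ t, HasDerivAt (fun t => (s t : ℂ)) (s' t : ℂ) t := fun t => (hs t).ofReal_comp
  have hsC' : ∀ t, HasDerivAt (fun t => (s' t : ℂ)) ((k * s t : ℝ) : ℂ) t :=
    fun t => (hs' t).ofReal_comp
  have hgW : ∀ t ∈ Ioc 0 L, HasDerivAt g (W t / (s t : ℂ) ^ 2) t := by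
    intro t ht
    have hne : (s t : ℂ) ≠ 0 := by exact_mod_cast (hpos t ht).ne'
    refine ((hv t).fun_div (hsC t) hne).congr_deriv ?_
    simp only [hW]; ring
  have hWd : ∀ t, HasDerivAt W ((c t - k) * s t * v t) t := by
    intro t
    refine (((hsC t).fun_mul (hv' t)).fun_sub ((hsC' t).fun_mul (hv t))).congr_deriv ?_
    push_cast; ring
  have hglim : Tendsto g (𝓝[>] 0) (𝓝 (v' 0)) := by
    have h1 := tendsto_div_nhdsGT_of_hasDerivAt (hv 0) h0
    have h2 := tendsto_div_nhdsGT_of_hasDerivAt (hsC 0) (by simp [hs0])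
    rw [hs1, Complex.ofReal_one] at h2
    have h3 := h1.div h2 one_ne_zero
    rw [div_one] at h3
    refine h3.congr' ?_
    filter_upwards [self_mem_nhdsWithin] with t ht
    have : (t : ℂ) ≠ 0 := by exact_mod_cast (ne_of_gt ht)
    simp only [Pi.div_apply, hg]
    field_simp
  have hW0 : Tendsto W (𝓝[>] 0) (𝓝 0) := by
    have := (hWd 0).continuousAt.tendsto
    simp only [hW, hs0, h0] at this
    simpa using this.mono_left nhdsWithin_le_nhds
  have hIoc : Ioc 0 L ∈ 𝓝[>] (0 : ℝ) := Ioc_mem_nhdsGT hL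
  -- `Re (conj g · W)` is increasing from `0`
  have hψ : ∀ t ∈ Ioc 0 L, HasDerivAt (fun t => (conj (g t) * W t).re)
      (‖W t‖ ^ 2 / s t ^ 2 + ((c t).re - k) * ‖v t‖ ^ 2) t := by
    intro t ht
    have hne := (hpos t ht).ne'
    have hneC : (s t : ℂ) ≠ 0 := by exact_mod_cast hne
    have h1 := (hgW t ht).star.fun_mul (hWd t)
    have h2 := Complex.reCLM.hasFDerivAt.comp_hasDerivAt t h1
    refine h2.congr_deriv ?_
    have e1 : star (W t / (s t : ℂ) ^ 2) * W t + star (g t) * ((c t - k) * s t * v t)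
        = ((‖W t‖ ^ 2 / s t ^ 2 : ℝ) : ℂ) + (c t - k) * ((‖v t‖ ^ 2 : ℝ) : ℂ) := by
      push_cast
      rw [← Complex.conj_mul', ← Complex.conj_mul']
      simp only [hg, star_div₀, star_pow, Complex.star_def, Complex.conj_ofReal]
      field_simp
    change (star (W t / (s t : ℂ) ^ 2) * W t + star (g t) * ((c t - k) * s t * v t)).re = _
    rw [e1, Complex.add_re, Complex.ofReal_re, Complex.re_mul_ofReal]
    simp
  have hψmono : MonotoneOn (fun t => (conj (g t) * W t).re) (Ioc 0 L) := by
    refine monotoneOn_of_deriv_nonneg (convex_Ioc 0 L)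
      (fun t ht => (hψ t ht).continuousAt.continuousWithinAt) ?_ ?_
    · intro t ht
      exact (hψ t (interior_subset ht)).differentiableAt.differentiableWithinAt
    · intro t ht
      rw [(hψ t (interior_subset ht)).deriv]
      have := sub_nonneg.2 (hc t)
      positivity
  have hψlim : Tendsto (fun t => (conj (g t) * W t).re) (𝓝[>] 0) (𝓝 0) := by
    have := (Complex.continuous_re.tendsto _).comp
      (((Complex.continuous_conj.tendsto _).comp hglim).mul hW0)
    rwa [mul_zero, Complex.zero_re] at this
  have hψnonneg : ∀ t ∈ Ioc 0 L, 0 ≤ (conj (g t) * W t).re := by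
    intro t ht
    refine le_of_tendsto hψlim ?_
    filter_upwards [Ioc_mem_nhdsGT ht.1] with x hx
    exact hψmono ⟨hx.1, hx.2.trans ht.2⟩ ht hx.2
  -- The sign just obtained is that of the derivative of |g|².
  have hN : ∀ t ∈ Ioc 0 L, HasDerivAt (fun t => ‖g t‖ ^ 2)
      (2 * (conj (g t) * W t).re / s t ^ 2) t := by
    intro t ht
    have hneC : (s t : ℂ) ≠ 0 := by exact_mod_cast (hpos t ht).ne'
    refine (hgW t ht).norm_sq.congr_deriv ?_
    rw [Complex.inner, show (W t / (s t : ℂ) ^ 2 * conj (g t))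
      = (conj (g t) * W t) * (((s t ^ 2)⁻¹ : ℝ) : ℂ) by push_cast; field_simp,
      Complex.re_mul_ofReal]
    ring
  have hNmono : MonotoneOn (fun t => ‖g t‖ ^ 2) (Ioc 0 L) := by
    refine monotoneOn_of_deriv_nonneg (convex_Ioc 0 L)
      (fun t ht => (hN t ht).continuousAt.continuousWithinAt) ?_ ?_
    · intro t ht
      exact (hN t (interior_subset ht)).differentiableAt.differentiableWithinAt
    · intro t ht
      rw [(hN t (interior_subset ht)).deriv]
      have := hψnonneg t (interior_subset ht)
      positivity
  have hfin : ‖v' 0‖ ^ 2 ≤ ‖g L‖ ^ 2 := by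
    refine le_of_tendsto (hglim.norm.pow 2) ?_
    filter_upwards [hIoc] with x hx
    exact hNmono hx ⟨hL, le_rfl⟩ hx.2
  have h4 := (pow_le_pow_iff_left₀ (norm_nonneg _) (norm_nonneg _) two_ne_zero).1 hfin
  have hsL := hpos L ⟨hL, le_rfl⟩
  simp only [hg, norm_div, Complex.norm_real, Real.norm_of_nonneg hsL.le] at h4
  rwa [le_div_iff₀ hsL] at h4

/-- Third-order expansion at `0` of a solution of `v'' = c v` with `v 0 = 0`. -/
theorem tendsto_norm_sub_div_cube {v v' c : ℝ → ℂ} {k : ℝ}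
    (hv : ∀ t, HasDerivAt v (v' t) t) (hv' : ∀ t, HasDerivAt v' (c t * v t) t) (h0 : v 0 = 0)
    (hc : ContinuousAt c 0) (hck : c 0 = k) :
    Tendsto (fun t : ℝ => (‖v t‖ - ‖v' 0‖ * t) / t ^ 3) (𝓝[>] 0) (𝓝 (‖v' 0‖ * k / 6)) := by
  set w := v' 0 with hw
  rw [Metric.tendsto_nhds]
  intro η hη
  have hdiv := ((hc.tendsto.mono_left (nhdsWithin_le_nhds (s := Ioi 0))).mul
    (tendsto_div_nhdsGT_of_hasDerivAt (hv 0) h0))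
  rw [Metric.tendsto_nhds] at hdiv
  obtain ⟨a, ha, hsub⟩ := mem_nhdsGT_iff_exists_Ioo_subset.1 (hdiv η hη)
  have ha : 0 < a := ha
  -- The error ηt in v'' ≈ k w t becomes ηt²/2 and then ηt³/6 after two integrations.
  have h1 : ∀ t ∈ Ico 0 a, ‖c t * v t - k * w * t‖ ≤ η * t := by
    intro t ht
    rcases ht.1.eq_or_lt with rfl | hpos
    · simp [h0]
    · have h : dist (c t * (v t / t)) (c 0 * v' 0) < η := hsub ⟨hpos, ht.2⟩
      replace h := h.le
      have ht0 : (t : ℂ) ≠ 0 := by exact_mod_cast hpos.ne'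
      rw [dist_eq_norm, hck] at h
      have : c t * v t - k * w * t = (c t * (v t / t) - k * v' 0) * t := by
        rw [hw]; field_simp
      rw [this, norm_mul, Complex.norm_real, Real.norm_of_nonneg hpos.le]
      gcongr
  have hmon : ∀ (n : ℕ) (b : ℂ) (t : ℝ),
      HasDerivAt (fun t : ℝ => b * (t : ℂ) ^ (n + 1)) (b * ((n + 1) * (t : ℂ) ^ n)) t := by
    intro n b t
    have := ((hasDerivAt_id t).ofReal_comp.pow (n + 1)).const_mul b
    simpa using this
  have hmonR : ∀ (n : ℕ) (b : ℝ) (t : ℝ),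
      HasDerivAt (fun t : ℝ => b * t ^ (n + 1)) (b * ((n + 1) * t ^ n)) t := by
    intro n b t
    have := ((hasDerivAt_id t).pow (n + 1)).const_mul b
    simpa using this
  have hd2 : ∀ t, HasDerivAt (fun t : ℝ => v' t - w - k * w / 2 * (t : ℂ) ^ 2)
      (c t * v t - k * w * t) t := by
    intro t
    refine (((hv' t).sub_const w).fun_sub (hmon 1 (k * w / 2) t)).congr_deriv ?_
    push_cast; ring
  have hd1 : ∀ t, HasDerivAt (fun t : ℝ => v t - w * (t : ℂ) ^ 1 - k * w / 6 * (t : ℂ) ^ 3)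
      (v' t - w - k * w / 2 * (t : ℂ) ^ 2) t := by
    intro t
    refine (((hv t).fun_sub (hmon 0 w t)).fun_sub (hmon 2 (k * w / 6) t)).congr_deriv ?_
    push_cast; ring
  have h2 : ∀ t ∈ Ico 0 a, ‖v' t - w - k * w / 2 * (t : ℂ) ^ 2‖ ≤ η / 2 * t ^ 2 := by
    intro t ht
    refine image_norm_le_of_norm_deriv_right_le_deriv_boundary
      (fun x _ => (hd2 x).continuousAt.continuousWithinAt)
      (fun x _ => (hd2 x).hasDerivWithinAt) (by simp [hw]) (fun x => hmonR 1 (η / 2) x) ?_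
      ⟨ht.1, le_rfl⟩
    intro x hx
    refine (h1 x ⟨hx.1, hx.2.trans ht.2⟩).trans_eq ?_
    push_cast; ring
  have h3 : ∀ t ∈ Ico 0 a, ‖v t - w * (t : ℂ) ^ 1 - k * w / 6 * (t : ℂ) ^ 3‖ ≤ η / 6 * t ^ 3 := by
    intro t ht
    refine image_norm_le_of_norm_deriv_right_le_deriv_boundary
      (fun x _ => (hd1 x).continuousAt.continuousWithinAt)
      (fun x _ => (hd1 x).hasDerivWithinAt) (by simp [h0]) (fun x => hmonR 2 (η / 6) x) ?_
      ⟨ht.1, le_rfl⟩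
    intro x hx
    refine (h2 x ⟨hx.1, hx.2.trans ht.2⟩).trans_eq ?_
    push_cast; ring
  -- Positivity of this factor lets the norm of the main term w t (1 + kt²/6) be computed exactly.
  have hsmall : ∀ᶠ t : ℝ in 𝓝[>] 0, 0 < 1 + k * t ^ 2 / 6 := by
    have : ContinuousAt (fun t : ℝ => 1 + k * t ^ 2 / 6) 0 := by fun_prop
    exact (this.eventually (lt_mem_nhds (by simp : (0 : ℝ) < 1 + k * 0 ^ 2 / 6))).filter_mono
      nhdsWithin_le_nhds
  filter_upwards [hsmall, Ioo_mem_nhdsGT ha] with t ht1 ht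
  have ht0 : 0 < t := ht.1
  have e : w * (t : ℂ) ^ 1 + k * w / 6 * (t : ℂ) ^ 3 = w * ((t * (1 + k * t ^ 2 / 6) : ℝ) : ℂ) := by
    push_cast; ring
  have hnorm : ‖w * (t : ℂ) ^ 1 + k * w / 6 * (t : ℂ) ^ 3‖ = ‖w‖ * (t * (1 + k * t ^ 2 / 6)) := by
    rw [e, norm_mul, Complex.norm_real, Real.norm_of_nonneg (by positivity)]
  have h4 := (abs_norm_sub_norm_le (v t) (w * (t : ℂ) ^ 1 + k * w / 6 * (t : ℂ) ^ 3)).trans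
    (by simpa only [sub_sub] using h3 t ⟨ht.1.le, ht.2⟩)
  rw [hnorm] at h4
  rw [Real.dist_eq]
  have e2 : (‖v t‖ - ‖w‖ * t) / t ^ 3 - ‖w‖ * k / 6
      = (‖v t‖ - ‖w‖ * (t * (1 + k * t ^ 2 / 6))) / t ^ 3 := by
    field_simp; ring
  rw [e2, abs_div, abs_of_pos (pow_pos ht0 3), div_lt_iff₀ (by positivity)]
  have : 0 < t ^ 3 := by positivity
  nlinarith

/-- Of two solutions of equations `v'' = c v`, vanishing at `0`, the one with the smaller value
of `c` at `0` is strictly smaller near `0`. -/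
theorem eventually_norm_lt_of_coeff_lt {v v' c s s' d : ℝ → ℂ} {k l : ℝ}
    (hv : ∀ t, HasDerivAt v (v' t) t) (hv' : ∀ t, HasDerivAt v' (c t * v t) t) (h0 : v 0 = 0)
    (hc : ContinuousAt c 0) (hck : c 0 = k) (hv0 : v' 0 ≠ 0)
    (hs : ∀ t, HasDerivAt s (s' t) t) (hs' : ∀ t, HasDerivAt s' (d t * s t) t) (hs0 : s 0 = 0)
    (hd : ContinuousAt d 0) (hdl : d 0 = l) (hs1 : s' 0 ≠ 0) (hkl : k < l) :
    ∀ᶠ t in 𝓝[>] 0, ‖v t‖ / ‖v' 0‖ < ‖s t‖ / ‖s' 0‖ := by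
  have hp1 := norm_pos_iff.2 hv0
  have hp2 := norm_pos_iff.2 hs1
  have h1 := (tendsto_norm_sub_div_cube hv hv' h0 hc hck).div_const ‖v' 0‖
  have h2 := (tendsto_norm_sub_div_cube hs hs' hs0 hd hdl).div_const ‖s' 0‖
  have hlt : ‖v' 0‖ * k / 6 / ‖v' 0‖ < ‖s' 0‖ * l / 6 / ‖s' 0‖ := by
    have e1 : ‖v' 0‖ * k / 6 / ‖v' 0‖ = k / 6 := by field_simp
    have e2 : ‖s' 0‖ * l / 6 / ‖s' 0‖ = l / 6 := by field_simp
    rw [e1, e2]; linarith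
  filter_upwards [h1.eventually_lt h2 hlt, self_mem_nhdsWithin] with t ht ht0
  have ht0 : 0 < t := ht0
  have e1 : (‖v t‖ - ‖v' 0‖ * t) / t ^ 3 / ‖v' 0‖ = (‖v t‖ / ‖v' 0‖ - t) / t ^ 3 := by field_simp
  have e2 : (‖s t‖ - ‖s' 0‖ * t) / t ^ 3 / ‖s' 0‖ = (‖s t‖ / ‖s' 0‖ - t) / t ^ 3 := by field_simp
  rw [e1, e2, div_lt_div_iff_of_pos_right (by positivity)] at ht
  linarith

/-! ### The unit disk and the Schwarz–Pick lemma. -/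

theorem mem_unitDisk_iff {z : ℂ} : z ∈ unitDisk ↔ ‖z‖ < 1 := by simp [unitDisk]

theorem isOpen_unitDisk : IsOpen unitDisk := Metric.isOpen_ball

theorem one_sub_conj_mul_ne_zero {a z : ℂ} (ha : ‖a‖ < 1) (hz : ‖z‖ ≤ 1) : 1 - conj a * z ≠ 0 := by
  intro h
  have h1 : ‖conj a * z‖ = 1 := by rw [← sub_eq_zero.1 h]; simp
  rw [norm_mul, RCLike.norm_conj] at h1
  nlinarith [norm_nonneg a, norm_nonneg z]

theorem normSq_one_sub_conj_mul_sub (a z : ℂ) :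
    ‖1 - conj a * z‖ ^ 2 - ‖z - a‖ ^ 2 = (1 - ‖a‖ ^ 2) * (1 - ‖z‖ ^ 2) := by
  simp only [← Complex.normSq_eq_norm_sq, Complex.normSq_apply]
  simp
  ring

theorem norm_sub_div_one_sub_conj_mul_lt {a z : ℂ} (ha : ‖a‖ < 1) (hz : ‖z‖ < 1) :
    ‖(z - a) / (1 - conj a * z)‖ < 1 := by
  have hne := norm_pos_iff.2 (one_sub_conj_mul_ne_zero ha hz.le)
  rw [norm_div, div_lt_one hne]
  have h := normSq_one_sub_conj_mul_sub a z
  have : 0 < (1 - ‖a‖ ^ 2) * (1 - ‖z‖ ^ 2) := by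
    apply mul_pos <;> nlinarith [norm_nonneg a, norm_nonneg z]
  exact lt_of_pow_lt_pow_left₀ 2 hne.le (by linarith)

/-- The **Schwarz–Pick lemma**, infinitesimal form, for maps into the open disk. -/
theorem schwarz_pick_of_mapsTo_unitDisk {g : ℂ → ℂ} (hg : DifferentiableOn ℂ g unitDisk)
    (hmaps : MapsTo g unitDisk unitDisk) {z : ℂ} (hz : z ∈ unitDisk) :
    ‖deriv g z‖ * (1 - ‖z‖ ^ 2) ≤ 1 - ‖g z‖ ^ 2 := by
  have hz1 := mem_unitDisk_iff.1 hz
  have hg1 := mem_unitDisk_iff.1 (hmaps hz)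
  have hnz : ‖-z‖ < 1 := by simpa
  -- `M` carries 0 to z and `N` carries g(z) to 0, so the Schwarz lemma at 0 applies to N ∘ g ∘ M.
  set M : ℂ → ℂ := fun w => (w - -z) / (1 - conj (-z) * w) with hM
  set N : ℂ → ℂ := fun w => (w - g z) / (1 - conj (g z) * w) with hN
  have hdisk : ∀ (a w : ℂ), ‖a‖ < 1 → ‖w‖ < 1 → HasDerivAt
      (fun w => (w - a) / (1 - conj a * w)) ((1 - conj a * a) / (1 - conj a * w) ^ 2) w := by
    intro a w ha hw
    have hne := one_sub_conj_mul_ne_zero ha hw.le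
    have h1 : HasDerivAt (fun w => 1 - conj a * w) (-(conj a)) w := by
      simpa using ((hasDerivAt_id w).const_mul (conj a)).const_sub 1
    refine (((hasDerivAt_id' w).sub_const a).fun_div h1 hne).congr_deriv ?_
    congr 1
    ring
  have hM0 : M 0 = z := by simp [hM]
  have hMmaps : MapsTo M unitDisk unitDisk := fun w hw =>
    mem_unitDisk_iff.2 (norm_sub_div_one_sub_conj_mul_lt hnz (mem_unitDisk_iff.1 hw))
  have hMd : DifferentiableOn ℂ M unitDisk := fun w hw =>
    (hdisk (-z) w hnz (mem_unitDisk_iff.1 hw)).differentiableAt.differentiableWithinAt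
  have hNd : DifferentiableOn ℂ N unitDisk := fun w hw =>
    (hdisk (g z) w hg1 (mem_unitDisk_iff.1 hw)).differentiableAt.differentiableWithinAt
  have hNmaps : MapsTo N unitDisk unitDisk := fun w hw =>
    mem_unitDisk_iff.2 (norm_sub_div_one_sub_conj_mul_lt hg1 (mem_unitDisk_iff.1 hw))
  have hh : DifferentiableOn ℂ (N ∘ g ∘ M) unitDisk :=
    hNd.comp (hg.comp hMd hMmaps) (hmaps.comp hMmaps)
  have hh0 : (N ∘ g ∘ M) 0 = 0 := by simp [hM0, hN]
  have hle : ‖deriv (N ∘ g ∘ M) 0‖ ≤ 1 := by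
    refine Complex.norm_deriv_le_one_of_mapsTo_ball hh (fun w hw => ?_) one_pos
    rw [hh0]
    exact Metric.ball_subset_closedBall (hNmaps (hmaps (hMmaps hw)))
  have hgd : HasDerivAt g (deriv g z) (M 0) := by
    rw [hM0]
    exact (hg.differentiableAt (isOpen_unitDisk.mem_nhds hz)).hasDerivAt
  have hder := HasDerivAt.comp (0 : ℂ) (h₂ := N) (h := g ∘ M)
    (by simpa [hM0] using hdisk (g z) (g z) hg1 hg1)
    (hgd.comp (0 : ℂ) (hdisk (-z) 0 hnz (by simp)))
  rw [hder.deriv] at hle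
  have hneg : (1 - ‖g z‖ ^ 2 : ℝ) ≠ 0 := by nlinarith [norm_nonneg (g z)]
  have hgp : 0 < 1 - ‖g z‖ ^ 2 := by nlinarith [norm_nonneg (g z)]
  have hzp : 0 < 1 - ‖z‖ ^ 2 := by nlinarith [norm_nonneg z]
  have e : (1 - conj (g z) * g z) / (1 - conj (g z) * g z) ^ 2 *
      (deriv g z * ((1 - conj (-z) * -z) / (1 - conj (-z) * 0) ^ 2))
      = (((1 - ‖g z‖ ^ 2 : ℝ)⁻¹ * (1 - ‖z‖ ^ 2) : ℝ) : ℂ) * deriv g z := by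
    have hneC : ((1 : ℂ) - ‖g z‖ ^ 2) ≠ 0 := by exact_mod_cast hneg
    rw [map_neg, neg_mul_neg, Complex.conj_mul', Complex.conj_mul']
    push_cast
    field_simp
    simp
  rw [e, norm_mul, Complex.norm_real, Real.norm_of_nonneg (by positivity), inv_mul_eq_div,
    div_mul_eq_mul_div, div_le_one hgp] at hle
  linarith

/-- The **Schwarz–Pick lemma**, infinitesimal form, for maps into the closed disk. -/
theorem schwarz_pick_of_norm_le_one {g : ℂ → ℂ} (hg : DifferentiableOn ℂ g unitDisk)
    (hmaps : ∀ z ∈ unitDisk, ‖g z‖ ≤ 1) {z : ℂ} (hz : z ∈ unitDisk) :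
    ‖deriv g z‖ * (1 - ‖z‖ ^ 2) ≤ 1 - ‖g z‖ ^ 2 := by
  -- For t < 1 the map t·g takes values in the open disk; then t → 1.
  have key : ∀ t ∈ Ioo (0 : ℝ) 1, t * ‖deriv g z‖ * (1 - ‖z‖ ^ 2) ≤ 1 - (t * ‖g z‖) ^ 2 := by
    intro t ht
    have h := schwarz_pick_of_mapsTo_unitDisk (g := fun w => (t : ℂ) * g w) (hg.const_mul _)
      (fun w hw => mem_unitDisk_iff.2 (by
        rw [norm_mul, Complex.norm_real, Real.norm_of_nonneg ht.1.le]
        nlinarith [hmaps w hw, ht.1, ht.2])) hz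
    rwa [deriv_const_mul _ (hg.differentiableAt (isOpen_unitDisk.mem_nhds hz)), norm_mul, norm_mul,
      Complex.norm_real, Real.norm_of_nonneg ht.1.le] at h
  have h1 : Tendsto (fun t : ℝ => t * ‖deriv g z‖ * (1 - ‖z‖ ^ 2)) (𝓝[<] 1)
      (𝓝 (1 * ‖deriv g z‖ * (1 - ‖z‖ ^ 2))) :=
    (Continuous.tendsto (by fun_prop) _).mono_left nhdsWithin_le_nhds
  have h2 : Tendsto (fun t : ℝ => 1 - (t * ‖g z‖) ^ 2) (𝓝[<] 1) (𝓝 (1 - (1 * ‖g z‖) ^ 2)) :=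
    (Continuous.tendsto (by fun_prop) _).mono_left nhdsWithin_le_nhds
  have := le_of_tendsto_of_tendsto h1 h2 (by
    filter_upwards [Ioo_mem_nhdsLT (zero_lt_one' ℝ)] with t ht using key t ht)
  simpa using this

/-! ### The Schwarzian derivative on F(α). -/

/-- The Schwarzian derivative `(f''/f')' - (f''/f')² / 2`. -/
noncomputable def schwarzian (f : ℂ → ℂ) (z : ℂ) : ℂ :=
  deriv (logDeriv (deriv f)) z - logDeriv (deriv f) z ^ 2 / 2

theorem differentiableOn_logDeriv_deriv {f : ℂ → ℂ} (hf : DifferentiableOn ℂ f unitDisk)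
    (hf' : ∀ z ∈ unitDisk, deriv f z ≠ 0) :
    DifferentiableOn ℂ (logDeriv (deriv f)) unitDisk :=
  ((hf.deriv isOpen_unitDisk).deriv isOpen_unitDisk).div (hf.deriv isOpen_unitDisk) hf'

theorem differentiableOn_schwarzian {f : ℂ → ℂ} (hf : DifferentiableOn ℂ f unitDisk)
    (hf' : ∀ z ∈ unitDisk, deriv f z ≠ 0) : DifferentiableOn ℂ (schwarzian f) unitDisk :=
  have hT := differentiableOn_logDeriv_deriv hf hf'
  (hT.deriv isOpen_unitDisk).sub ((hT.pow 2).div_const 2)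

/-- Put X = 1 - rs and Y = |s - r|. Then (1 - r²)(1 - s²) = X² - Y² and (1 - r²)s = rX + (s - r), so
the left side is at most X² - Y² + a(X + Y)². Multiplied by 1 - a, this equals X² - (aX - (1 -
a)Y)². In the application r = |z|, s = |φ(z)|, p = |φ'(z)|, a = -α and m = |1 - zφ(z)|. -/
theorem schwarzian_bound_aux {a r s p m : ℝ} (ha : 0 ≤ a) (ha1 : a < 1) (hr : 0 ≤ r) (hr1 : r < 1)
    (hs1 : s ≤ 1) (hp : p * (1 - r ^ 2) ≤ 1 - s ^ 2) (hm : 1 - r * s ≤ m) :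
    (1 - r ^ 2) ^ 2 * (p + a * s ^ 2) ≤ m ^ 2 / (1 - a) := by
  have hX : 0 < 1 - r * s := by nlinarith
  have h1 : (1 - r ^ 2) ^ 2 * (p + a * s ^ 2)
      ≤ (1 - r * s) ^ 2 - (s - r) ^ 2 + a * (r * (1 - r * s) + (s - r)) ^ 2 := by
    have : 0 ≤ 1 - r ^ 2 := by nlinarith
    nlinarith [mul_le_mul_of_nonneg_left hp this]
  have h2 : (r * (1 - r * s) + (s - r)) ^ 2 ≤ ((1 - r * s) + |s - r|) ^ 2 := by
    refine sq_le_sq.2 ?_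
    rw [abs_of_nonneg (by positivity : 0 ≤ (1 - r * s) + |s - r|)]
    refine (abs_add_le _ _).trans ?_
    rw [abs_of_nonneg (by positivity)]
    nlinarith
  have h3 : (1 - r * s) ^ 2 ≤ m ^ 2 := by gcongr
  rw [le_div_iff₀ (by linarith)]
  have h4 : (s - r) ^ 2 = |s - r| ^ 2 := (sq_abs _).symm
  have h5 := mul_le_mul_of_nonneg_left h2 ha
  have h6 : (1 - r ^ 2) ^ 2 * (p + a * s ^ 2) * (1 - a) ≤
      ((1 - r * s) ^ 2 - |s - r| ^ 2 + a * ((1 - r * s) + |s - r|) ^ 2) * (1 - a) := by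
    refine mul_le_mul_of_nonneg_right ?_ (by linarith)
    rw [← h4]; linarith
  nlinarith [sq_nonneg (a * (1 - r * s) - (1 - a) * |s - r|)]

/-- The sharp bound of the Schwarzian norm on `classF α`. -/
theorem norm_schwarzian_le {α : ℝ} (hα : -1 < α) (hα' : α ≤ 0) {f : ℂ → ℂ} (hf : f ∈ classF α)
    {z : ℂ} (hz : z ∈ unitDisk) :
    (1 - ‖z‖ ^ 2) ^ 2 * ‖schwarzian f z‖ ≤ 2 * ((1 - α) / (1 + α)) := by
  obtain ⟨⟨hfd, -, -⟩, hf', hre⟩ := hf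
  have hTd := differentiableOn_logDeriv_deriv hfd hf'
  set T := logDeriv (deriv f) with hT
  -- With this `B` the hypothesis reads Re(zT) > -B/2, and u ↦ u/(B + u) maps that half-plane to the
  -- unit disk.
  set B : ℝ := 2 * (1 - α) with hB
  have hBpos : 0 < B := by rw [hB]; linarith
  have hreT : ∀ w ∈ unitDisk, α - 1 < (w * T w).re := by
    intro w hw
    have := hre w hw
    rw [mul_div_assoc] at this
    simp only [Complex.add_re, Complex.one_re] at this
    simp only [hT, logDeriv_apply]
    linarith
  have hden : ∀ w ∈ unitDisk, (B : ℂ) + w * T w ≠ 0 := by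
    intro w hw h
    have h1 := hreT w hw
    have h2 := congrArg Complex.re h
    simp only [Complex.add_re, Complex.ofReal_re, Complex.zero_re] at h2
    rw [hB] at h2
    linarith
  set φ : ℂ → ℂ := fun w => T w / (B + w * T w) with hφ
  have hdend : DifferentiableOn ℂ (fun w => (B : ℂ) + w * T w) unitDisk :=
    (differentiableOn_id.mul hTd).const_add _
  have hφd : DifferentiableOn ℂ φ unitDisk := hTd.div hdend hden
  have hωlt : ∀ w ∈ unitDisk, ‖w * φ w‖ < 1 := by
    intro w hw
    have e : w * φ w = (w * T w) / (B + w * T w) := by simp only [hφ]; ring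
    have hp := norm_pos_iff.2 (hden w hw)
    rw [e, norm_div, div_lt_one hp]
    refine lt_of_pow_lt_pow_left₀ 2 hp.le ?_
    rw [← Complex.normSq_eq_norm_sq, ← Complex.normSq_eq_norm_sq, Complex.normSq_add]
    simp only [Complex.normSq_ofReal, Complex.re_ofReal_mul, Complex.conj_re]
    have := hreT w hw
    nlinarith
  have hωd : DifferentiableOn ℂ (fun w => w * φ w) unitDisk := differentiableOn_id.mul hφd
  have hωmaps : MapsTo (fun w => w * φ w) (Metric.ball 0 1) (Metric.closedBall 0 1) := fun w hw => by
    simpa using (hωlt w hw).le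
  have hφle : ∀ w ∈ unitDisk, ‖φ w‖ ≤ 1 := by
    intro w hw
    -- At w = 0 the factor w cannot be cancelled, but φ(0) is the derivative of wφ(w) there.
    rcases eq_or_ne w 0 with rfl | hw0
    · have h1 := Complex.norm_deriv_le_one_of_mapsTo_ball hωd (by simpa using hωmaps) one_pos
      have h2 := (hasDerivAt_id' (0 : ℂ)).fun_mul
        (hφd.differentiableAt (isOpen_unitDisk.mem_nhds hw)).hasDerivAt
      rw [h2.deriv] at h1
      simpa using h1
    · have h1 := Complex.norm_le_norm_of_mapsTo_ball hωd hωmaps (by simp)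
        (mem_unitDisk_iff.1 hw)
      rw [norm_mul] at h1
      exact le_of_mul_le_mul_left (by linarith) (norm_pos_iff.2 hw0)
  have hSP := schwarz_pick_of_norm_le_one hφd hφle hz
  have hz1 := mem_unitDisk_iff.1 hz
  have hTz : HasDerivAt T (deriv T z) z :=
    (hTd.differentiableAt (isOpen_unitDisk.mem_nhds hz)).hasDerivAt
  have hφz : deriv φ z = (B * deriv T z - T z ^ 2) / (B + z * T z) ^ 2 := by
    rw [(hTz.fun_div (((hasDerivAt_id' z).fun_mul hTz).const_add (B : ℂ)) (hden z hz)).deriv]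
    congr 1
    ring
  have hBC : (B : ℂ) ≠ 0 := by exact_mod_cast hBpos.ne'
  have hne := hden z hz
  have h1φ : 1 - z * φ z = B / (B + z * T z) := by
    simp only [hφ]; field_simp; ring
  -- Here T = Bφ/(1 - zφ), so T' contributes φ' + φ² and -T²/2 contributes -(B/2)φ²; the coefficient
  -- of φ² is 1 - B/2 = α.
  have hS : schwarzian f z * (1 - z * φ z) ^ 2 = B * (deriv φ z + α * φ z ^ 2) := by
    have hα2 : (α : ℂ) = 1 - B / 2 := by rw [hB]; push_cast; ring
    rw [h1φ, hφz, schwarzian, ← hT, hα2]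
    simp only [hφ]
    field_simp
    ring
  set m := ‖1 - z * φ z‖ with hm
  have hmle : 1 - ‖z‖ * ‖φ z‖ ≤ m := by
    have := norm_sub_norm_le (1 : ℂ) (z * φ z)
    simpa using this
  have hmpos : 0 < m := by
    rw [hm, h1φ]
    exact norm_pos_iff.2 (div_ne_zero hBC hne)
  have hmain := schwarzian_bound_aux (a := -α) (by linarith) (by linarith) (norm_nonneg z) hz1
    (hφle z hz) hSP hmle
  have hSn : ‖schwarzian f z‖ * m ^ 2 ≤ B * (‖deriv φ z‖ + -α * ‖φ z‖ ^ 2) := by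
    rw [hm, ← norm_pow, ← norm_mul, hS, norm_mul, Complex.norm_real, Real.norm_of_nonneg hBpos.le]
    refine mul_le_mul_of_nonneg_left ((norm_add_le _ _).trans_eq ?_) hBpos.le
    rw [norm_mul, norm_pow, Complex.norm_real, Real.norm_of_nonpos hα']
  have hm2 : 0 < m ^ 2 := by positivity
  refine le_of_mul_le_mul_right ?_ hm2
  calc (1 - ‖z‖ ^ 2) ^ 2 * ‖schwarzian f z‖ * m ^ 2
      = (1 - ‖z‖ ^ 2) ^ 2 * (‖schwarzian f z‖ * m ^ 2) := by ring
    _ ≤ (1 - ‖z‖ ^ 2) ^ 2 * (B * (‖deriv φ z‖ + -α * ‖φ z‖ ^ 2)) := by gcongr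
    _ = B * ((1 - ‖z‖ ^ 2) ^ 2 * (‖deriv φ z‖ + -α * ‖φ z‖ ^ 2)) := by ring
    _ ≤ B * (m ^ 2 / (1 - -α)) := by gcongr
    _ = 2 * ((1 - α) / (1 + α)) * m ^ 2 := by rw [hB, sub_neg_eq_add]; ring

/-! ### Hyperbolic geodesics as Möbius images of the diameters ζ tanh t. -/

/-- The denominator of the geodesic `hypGeodesic`. -/
noncomputable def hypGeodesicDen (z₁ ζ : ℂ) (t : ℝ) : ℂ :=
  (Real.cosh t : ℂ) + conj z₁ * ζ * (Real.sinh t : ℂ)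

/-- The geodesic of the unit disk starting at `z₁` in the direction `ζ`, parametrized by hyperbolic
arc length. -/
noncomputable def hypGeodesic (z₁ ζ : ℂ) (t : ℝ) : ℂ :=
  (z₁ * (Real.cosh t : ℂ) + ζ * (Real.sinh t : ℂ)) / hypGeodesicDen z₁ ζ t

/-- The velocity of `hypGeodesic`. -/
noncomputable def hypVelocity (z₁ ζ : ℂ) (t : ℝ) : ℂ :=
  ζ * (1 - conj z₁ * z₁) / hypGeodesicDen z₁ ζ t ^ 2

/-- The matrix with rows (1, z₁) and (conj z₁, 1) multiplies the form |D|² - |N|² by 1 - |z₁|², and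
on the vector (ζ sinh t, cosh t) this form is cosh² t - sinh² t = 1. -/
theorem normSq_hypGeodesicDen_sub {z₁ ζ : ℂ} (hζ : ‖ζ‖ = 1) (t : ℝ) :
    ‖hypGeodesicDen z₁ ζ t‖ ^ 2 - ‖z₁ * (Real.cosh t : ℂ) + ζ * (Real.sinh t : ℂ)‖ ^ 2
      = 1 - ‖z₁‖ ^ 2 := by
  have h1 : ζ.re * ζ.re + ζ.im * ζ.im = 1 := by
    rw [← Complex.normSq_apply, Complex.normSq_eq_norm_sq, hζ, one_pow]
  have h2 := Real.cosh_sq t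
  simp only [hypGeodesicDen, ← Complex.normSq_eq_norm_sq, Complex.normSq_apply, Complex.add_re,
    Complex.add_im, Complex.mul_re, Complex.mul_im, Complex.ofReal_re, Complex.ofReal_im,
    Complex.conj_re, Complex.conj_im]
  linear_combination (1 - z₁.re ^ 2 - z₁.im ^ 2) * h2
    + (Real.sinh t ^ 2 * (z₁.re ^ 2 + z₁.im ^ 2 - 1)) * h1

theorem hypGeodesicDen_ne_zero {z₁ ζ : ℂ} (hz : ‖z₁‖ < 1) (hζ : ‖ζ‖ = 1) (t : ℝ) :
    hypGeodesicDen z₁ ζ t ≠ 0 := by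
  intro h
  have h1 := normSq_hypGeodesicDen_sub (z₁ := z₁) hζ t
  rw [h, norm_zero] at h1
  nlinarith [norm_nonneg z₁, sq_nonneg ‖z₁ * (Real.cosh t : ℂ) + ζ * (Real.sinh t : ℂ)‖]

theorem one_sub_normSq_hypGeodesic {z₁ ζ : ℂ} (hz : ‖z₁‖ < 1) (hζ : ‖ζ‖ = 1) (t : ℝ) :
    1 - ‖hypGeodesic z₁ ζ t‖ ^ 2 = (1 - ‖z₁‖ ^ 2) / ‖hypGeodesicDen z₁ ζ t‖ ^ 2 := by
  have hne := norm_ne_zero_iff.2 (hypGeodesicDen_ne_zero hz hζ t)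
  rw [← normSq_hypGeodesicDen_sub (z₁ := z₁) hζ t, hypGeodesic, norm_div]
  field_simp

theorem hypGeodesic_mem_unitDisk {z₁ ζ : ℂ} (hz : ‖z₁‖ < 1) (hζ : ‖ζ‖ = 1) (t : ℝ) :
    hypGeodesic z₁ ζ t ∈ unitDisk := by
  rw [mem_unitDisk_iff]
  have h := one_sub_normSq_hypGeodesic hz hζ t
  have hp := norm_pos_iff.2 (hypGeodesicDen_ne_zero hz hζ t)
  have h2 : 0 < 1 - ‖z₁‖ ^ 2 := by nlinarith [norm_nonneg z₁]
  have : 0 < 1 - ‖hypGeodesic z₁ ζ t‖ ^ 2 := by rw [h]; positivity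
  nlinarith [norm_nonneg (hypGeodesic z₁ ζ t)]

theorem hypGeodesicDen_zero (z₁ ζ : ℂ) : hypGeodesicDen z₁ ζ 0 = 1 := by simp [hypGeodesicDen]

theorem hypGeodesic_zero (z₁ ζ : ℂ) : hypGeodesic z₁ ζ 0 = z₁ := by
  simp [hypGeodesic, hypGeodesicDen_zero]

/-- Unit hyperbolic speed: it turns the weight (1 - |z|²)² of the Schwarzian norm into |γ'|². -/
theorem norm_hypVelocity {z₁ ζ : ℂ} (hz : ‖z₁‖ < 1) (hζ : ‖ζ‖ = 1) (t : ℝ) :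
    ‖hypVelocity z₁ ζ t‖ = 1 - ‖hypGeodesic z₁ ζ t‖ ^ 2 := by
  have h2 : 0 < 1 - ‖z₁‖ ^ 2 := by nlinarith [norm_nonneg z₁]
  rw [one_sub_normSq_hypGeodesic hz hζ, hypVelocity, norm_div, norm_mul, hζ, one_mul, norm_pow,
    Complex.conj_mul', ← Complex.ofReal_pow, ← Complex.ofReal_one, ← Complex.ofReal_sub,
    Complex.norm_real, Real.norm_of_nonneg h2.le]

theorem hasDerivAt_ofReal_cosh (t : ℝ) :
    HasDerivAt (fun t : ℝ => (Real.cosh t : ℂ)) (Real.sinh t : ℂ) t :=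
  (Real.hasDerivAt_cosh t).ofReal_comp

theorem hasDerivAt_ofReal_sinh (t : ℝ) :
    HasDerivAt (fun t : ℝ => (Real.sinh t : ℂ)) (Real.cosh t : ℂ) t :=
  (Real.hasDerivAt_sinh t).ofReal_comp

theorem hasDerivAt_hypGeodesicDen (z₁ ζ : ℂ) (t : ℝ) : HasDerivAt (hypGeodesicDen z₁ ζ)
    ((Real.sinh t : ℂ) + conj z₁ * ζ * (Real.cosh t : ℂ)) t :=
  (hasDerivAt_ofReal_cosh t).fun_add ((hasDerivAt_ofReal_sinh t).const_mul _)

theorem hasDerivAt_hypGeodesic {z₁ ζ : ℂ} (hz : ‖z₁‖ < 1) (hζ : ‖ζ‖ = 1) (t : ℝ) :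
    HasDerivAt (hypGeodesic z₁ ζ) (hypVelocity z₁ ζ t) t := by
  have hne := hypGeodesicDen_ne_zero hz hζ t
  refine ((((hasDerivAt_ofReal_cosh t).const_mul z₁).fun_add
    ((hasDerivAt_ofReal_sinh t).const_mul ζ)).fun_div
    (hasDerivAt_hypGeodesicDen z₁ ζ t) hne).congr_deriv ?_
  rw [hypVelocity]
  congr 1
  have h : (Real.cosh t : ℂ) ^ 2 = (Real.sinh t : ℂ) ^ 2 + 1 := by exact_mod_cast Real.cosh_sq t
  rw [hypGeodesicDen]
  linear_combination (ζ * (1 - conj z₁ * z₁)) * h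

theorem hypDist_hypGeodesic {z₁ ζ : ℂ} (hz : ‖z₁‖ < 1) (hζ : ‖ζ‖ = 1) {t : ℝ} (ht : 0 ≤ t) :
    hypDist z₁ (hypGeodesic z₁ ζ t) = t := by
  have hne := hypGeodesicDen_ne_zero hz hζ t
  have hc : (Real.cosh t : ℂ) ≠ 0 := by exact_mod_cast (Real.cosh_pos t).ne'
  have h1 : (1 : ℂ) - conj z₁ * z₁ ≠ 0 := one_sub_conj_mul_ne_zero hz hz.le
  have e1 : z₁ - hypGeodesic z₁ ζ t
      = -(ζ * Real.sinh t * (1 - conj z₁ * z₁)) / hypGeodesicDen z₁ ζ t := by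
    rw [hypGeodesic, eq_div_iff hne, sub_mul, div_mul_cancel₀ _ hne, hypGeodesicDen]
    ring
  have e2 : 1 - conj z₁ * hypGeodesic z₁ ζ t
      = Real.cosh t * (1 - conj z₁ * z₁) / hypGeodesicDen z₁ ζ t := by
    rw [hypGeodesic, eq_div_iff hne, sub_mul, mul_assoc (conj z₁), div_mul_cancel₀ _ hne,
      hypGeodesicDen]
    ring
  have hpd : pseudoHypDist z₁ (hypGeodesic z₁ ζ t) = Real.tanh t := by
    have e3 : (z₁ - hypGeodesic z₁ ζ t) / (1 - conj z₁ * hypGeodesic z₁ ζ t)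
        = -ζ * ((Real.tanh t : ℝ) : ℂ) := by
      rw [e1, e2, Real.tanh_eq_sinh_div_cosh, Complex.ofReal_div]
      field_simp
    rw [pseudoHypDist, e3, norm_mul, norm_neg, hζ, one_mul, Complex.norm_real,
      Real.norm_of_nonneg]
    rw [Real.tanh_eq_sinh_div_cosh]
    exact div_nonneg (Real.sinh_nonneg_iff.2 ht) (Real.cosh_pos t).le
  rw [hypDist, hpd, ← Real.artanh_eq_half_log ⟨(Real.neg_one_lt_tanh t).le, (Real.tanh_lt_one t).le⟩,
    Real.artanh_tanh]

/-- Any two points of the disk are joined by a geodesic. -/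
theorem exists_hypGeodesic_eq {z₁ z₂ : ℂ} (hz₁ : ‖z₁‖ < 1) (hz₂ : ‖z₂‖ < 1) :
    ∃ ζ : ℂ, ‖ζ‖ = 1 ∧ ∃ t : ℝ, 0 ≤ t ∧ hypGeodesic z₁ ζ t = z₂ := by
  -- The disk automorphism taking z₁ to 0 takes z₂ to `w`; its argument gives ζ and its modulus is
  -- tanh t.
  set w := (z₂ - z₁) / (1 - conj z₁ * z₂) with hw
  have hw1 : ‖w‖ < 1 := norm_sub_div_one_sub_conj_mul_lt hz₁ hz₂
  have hne := one_sub_conj_mul_ne_zero hz₁ hz₂.le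
  have hne1 : (1 : ℂ) - conj z₁ * z₁ ≠ 0 := one_sub_conj_mul_ne_zero hz₁ hz₁.le
  obtain ⟨ζ, hζ, hζw⟩ : ∃ ζ : ℂ, ‖ζ‖ = 1 ∧ ζ * (‖w‖ : ℂ) = w := by
    rcases eq_or_ne w 0 with h | h
    · exact ⟨1, by simp, by simp [h]⟩
    · have hn : (‖w‖ : ℂ) ≠ 0 := by exact_mod_cast norm_ne_zero_iff.2 h
      exact ⟨w / ‖w‖, by simp [h], by field_simp⟩
  have hmem : ‖w‖ ∈ Ioo (-1 : ℝ) 1 := ⟨by linarith [norm_nonneg w], hw1⟩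
  refine ⟨ζ, hζ, Real.artanh ‖w‖, ?_, ?_⟩
  · rcases (norm_nonneg w).eq_or_lt with h | h
    · rw [← h, Real.artanh_zero]
    · exact (Real.artanh_pos ⟨h, hw1⟩).le
  · set t := Real.artanh ‖w‖ with ht
    have hc : (Real.cosh t : ℂ) ≠ 0 := by exact_mod_cast (Real.cosh_pos t).ne'
    have hth : Real.sinh t = ‖w‖ * Real.cosh t := by
      have := Real.tanh_artanh hmem
      rw [Real.tanh_eq_sinh_div_cosh, div_eq_iff (Real.cosh_pos _).ne'] at this
      exact this
    have hs : ζ * (Real.sinh t : ℂ) = w * Real.cosh t := by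
      rw [hth]; push_cast; rw [← mul_assoc, hζw]
    have hwe : w * (1 - conj z₁ * z₂) = z₂ - z₁ := div_mul_cancel₀ _ hne
    rw [hypGeodesic, div_eq_iff (hypGeodesicDen_ne_zero hz₁ hζ t), hypGeodesicDen,
      mul_assoc (conj z₁), hs]
    linear_combination (Real.cosh t : ℂ) * hwe

/-! ### Two-point distortion as a solution of a linear equation. -/

/-- On the disk, a nonvanishing derivative has the inverse of a square root, which is the exponential
of a primitive of `-f'' / (2 f')`. -/
theorem exists_inv_sqrt_deriv {f : ℂ → ℂ} (hf : DifferentiableOn ℂ f unitDisk)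
    (hf' : ∀ z ∈ unitDisk, deriv f z ≠ 0) :
    ∃ E : ℂ → ℂ, (∀ z ∈ unitDisk, HasDerivAt E (-(logDeriv (deriv f) z) / 2 * E z) z) ∧
      ∀ z ∈ unitDisk, ‖E z‖ ^ 2 * ‖deriv f z‖ = 1 := by
  have hTd := differentiableOn_logDeriv_deriv hf hf'
  have h0 : (0 : ℂ) ∈ unitDisk := by simp [unitDisk]
  obtain ⟨P, hP0, hP⟩ := (DifferentiableOn.isExactOn_ball
    (hTd.neg.div_const 2)).with_val_at 0 (-Complex.log (deriv f 0) / 2)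
  have hE : ∀ z ∈ unitDisk, HasDerivAt (fun z => Complex.exp (P z))
      (-(logDeriv (deriv f) z) / 2 * Complex.exp (P z)) z := by
    intro z hz
    refine (hP z hz).cexp.congr_deriv ?_
    simp [mul_comm]
  refine ⟨fun z => Complex.exp (P z), hE, fun z hz => ?_⟩
  -- E² f' is constant, and the value chosen for P(0) makes the constant 1.
  have hconst : ∀ z ∈ unitDisk, HasDerivAt (fun z => Complex.exp (P z) ^ 2 * deriv f z) 0 z := by
    intro z hz
    have h1 := ((hf.deriv isOpen_unitDisk).differentiableAt (isOpen_unitDisk.mem_nhds hz)).hasDerivAt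
    refine (((hE z hz).fun_pow 2).fun_mul h1).congr_deriv ?_
    have := hf' z hz
    rw [logDeriv_apply]
    field_simp
    ring
  have heq := isOpen_unitDisk.is_const_of_deriv_eq_zero
    (Metric.isConnected_ball one_pos).isPreconnected
    (fun z hz => (hconst z hz).differentiableAt.differentiableWithinAt)
    (fun z hz => (hconst z hz).deriv) hz h0
  have hval : Complex.exp (P 0) ^ 2 * deriv f 0 = 1 := by
    rw [hP0, ← Complex.exp_nat_mul]
    push_cast
    rw [mul_div_cancel₀ _ two_ne_zero, Complex.exp_neg, Complex.exp_log (hf' 0 h0),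
      inv_mul_cancel₀ (hf' 0 h0)]
  simp only [hval] at heq
  rw [← norm_pow, ← norm_mul, heq, norm_one]

/-- Along a geodesic, the two-point distortion is the normalized modulus of a solution of a linear
second-order equation whose coefficient is given by the Schwarzian derivative. -/
theorem exists_solution_twoPointDistortion {f : ℂ → ℂ} (hf : DifferentiableOn ℂ f unitDisk)
    (hf' : ∀ z ∈ unitDisk, deriv f z ≠ 0) {z₁ ζ : ℂ} (hz : ‖z₁‖ < 1) (hζ : ‖ζ‖ = 1) :
    ∃ v v' : ℝ → ℂ, (∀ t, HasDerivAt v (v' t) t) ∧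
      (∀ t, HasDerivAt v' ((1 - schwarzian f (hypGeodesic z₁ ζ t) / 2 * hypVelocity z₁ ζ t ^ 2)
        * v t) t) ∧ v 0 = 0 ∧ v' 0 ≠ 0 ∧
      ∀ t, ‖v t‖ / ‖v' 0‖ = twoPointDistortion f z₁ (hypGeodesic z₁ ζ t) := by
  obtain ⟨E, hE, hEn⟩ := exists_inv_sqrt_deriv hf hf'
  have hTd := differentiableOn_logDeriv_deriv hf hf'
  set T := logDeriv (deriv f) with hT
  have hz' : z₁ ∈ unitDisk := mem_unitDisk_iff.2 hz
  set γ := hypGeodesic z₁ ζ with hγ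
  set D := hypGeodesicDen z₁ ζ with hD
  set K : ℂ := ζ * (1 - conj z₁ * z₁) with hK
  set V : ℂ → ℂ := fun z => (f z - f z₁) * E z with hV
  set V₁ : ℂ → ℂ := fun z => (deriv f z - (f z - f z₁) * T z / 2) * E z with hV₁
  have hfz : ∀ z ∈ unitDisk, HasDerivAt f (deriv f z) z := fun z hz =>
    (hf.differentiableAt (isOpen_unitDisk.mem_nhds hz)).hasDerivAt
  have hfz' : ∀ z ∈ unitDisk, HasDerivAt (deriv f) (deriv f z * T z) z := fun z hz => by
    refine ((hf.deriv isOpen_unitDisk).differentiableAt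
      (isOpen_unitDisk.mem_nhds hz)).hasDerivAt.congr_deriv ?_
    rw [hT, logDeriv_apply, mul_div_cancel₀ _ (hf' z hz)]
  have hTz : ∀ z ∈ unitDisk, HasDerivAt T (deriv T z) z := fun z hz =>
    (hTd.differentiableAt (isOpen_unitDisk.mem_nhds hz)).hasDerivAt
  have hVd : ∀ z ∈ unitDisk, HasDerivAt V (V₁ z) z := fun z hz => by
    refine (((hfz z hz).sub_const (f z₁)).fun_mul (hE z hz)).congr_deriv ?_
    simp only [hV₁]; ring
  have hVd' : ∀ z ∈ unitDisk, HasDerivAt V₁ (-(schwarzian f z) / 2 * V z) z := fun z hz => by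
    refine (((hfz' z hz).fun_sub ((((hfz z hz).sub_const (f z₁)).fun_mul
      (hTz z hz)).div_const 2)).fun_mul (hE z hz)).congr_deriv ?_
    simp only [hV, schwarzian, ← hT]; ring
  have hγm : ∀ t, γ t ∈ unitDisk := hypGeodesic_mem_unitDisk hz hζ
  have hDne : ∀ t, D t ≠ 0 := hypGeodesicDen_ne_zero hz hζ
  have hγd : ∀ t, HasDerivAt γ (K / D t ^ 2) t := hasDerivAt_hypGeodesic hz hζ
  set D₁ : ℝ → ℂ := fun t => (Real.sinh t : ℂ) + conj z₁ * ζ * (Real.cosh t : ℂ) with hD₁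
  have hDd : ∀ t, HasDerivAt D (D₁ t) t := hasDerivAt_hypGeodesicDen z₁ ζ
  have hDd' : ∀ t, HasDerivAt D₁ (D t) t := fun t =>
    (hasDerivAt_ofReal_sinh t).fun_add ((hasDerivAt_ofReal_cosh t).const_mul _)
  have hVγ : ∀ t, HasDerivAt (fun t => V (γ t)) (K / D t ^ 2 * V₁ (γ t)) t := fun t =>
    (hVd (γ t) (hγm t)).scomp t (hγd t)
  have hVγ' : ∀ t, HasDerivAt (fun t => V₁ (γ t))
      (K / D t ^ 2 * (-(schwarzian f (γ t)) / 2 * V (γ t))) t := fun t =>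
    (hVd' (γ t) (hγm t)).scomp t (hγd t)
  have hD0 : D 0 = 1 := hypGeodesicDen_zero z₁ ζ
  have hγ0 : γ 0 = z₁ := hypGeodesic_zero z₁ ζ
  have hEne : ∀ z ∈ unitDisk, 0 < ‖E z‖ := fun z hz => by
    rw [norm_pos_iff]
    intro h
    simpa [h] using hEn z hz
  have hzp : 0 < 1 - ‖z₁‖ ^ 2 := by nlinarith [norm_nonneg z₁]
  have hKn : ‖K‖ = 1 - ‖z₁‖ ^ 2 := by
    have := norm_hypVelocity hz hζ 0
    rwa [hypVelocity, hypGeodesicDen_zero, one_pow, div_one, hypGeodesic_zero] at this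
  have hv0 : ‖D₁ 0 * V (γ 0) + K * V₁ (γ 0) / D 0‖ = (1 - ‖z₁‖ ^ 2) * (‖deriv f z₁‖ * ‖E z₁‖) := by
    rw [hD0, hγ0, ← hKn, ← norm_mul, ← norm_mul]
    simp [hV, hV₁]
  have hf1 : 0 < ‖deriv f z₁‖ := norm_pos_iff.2 (hf' z₁ hz')
  have hE1 := hEne z₁ hz'
  -- Since γ' = K/D², the factor `D` cancels the first-order term in the equation for V ∘ γ, and D''
  -- = D produces the summand 1 of the coefficient.
  refine ⟨fun t => D t * V (γ t), fun t => D₁ t * V (γ t) + K * V₁ (γ t) / D t, fun t => ?_,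
    fun t => ?_, ?_, ?_, fun t => ?_⟩
  · refine ((hDd t).fun_mul (hVγ t)).congr_deriv ?_
    have := hDne t
    field_simp
  · refine (((hDd' t).fun_mul (hVγ t)).fun_add
      (((hVγ' t).const_mul K).fun_div (hDd t) (hDne t))).congr_deriv ?_
    have := hDne t
    rw [hypVelocity, ← hD, ← hK]
    field_simp
    ring
  · simp [hγ0, hV]
  · rw [← norm_pos_iff, hv0]
    positivity
  · have hE2 := hEne _ (hγm t)
    have hDp := norm_pos_iff.2 (hDne t)
    have hfp : 0 < ‖deriv f (γ t)‖ := norm_pos_iff.2 (hf' _ (hγm t))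
    simp only [hv0]
    have hsq : √((1 - ‖z₁‖ ^ 2) * ‖deriv f z₁‖ * ((1 - ‖γ t‖ ^ 2) * ‖deriv f (γ t)‖))
        = (1 - ‖z₁‖ ^ 2) * (‖deriv f z₁‖ * ‖E z₁‖) / (‖D t‖ * ‖E (γ t)‖) := by
      rw [one_sub_normSq_hypGeodesic hz hζ, ← hD, Real.sqrt_eq_iff_mul_self_eq_of_pos (by positivity)]
      have h1 := hEn z₁ hz'
      have h2 := hEn _ (hγm t)
      rw [div_mul_div_comm, div_eq_iff (by positivity)]
      field_simp
      linear_combination h1 - h2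
    rw [twoPointDistortion, hsq]
    simp only [hV, norm_mul]
    rw [norm_sub_rev (f z₁)]
    field_simp

/-! ### Extremal functions for the Schwarzian bound. -/

theorem re_one_sub_sq_mul_conj (c : ℝ) (z : ℂ) :
    ((1 - z ^ 2) * conj (1 - 2 * c * z + z ^ 2)).re
      = (1 - ‖z‖ ^ 2) * (1 + ‖z‖ ^ 2 - 2 * c * z.re) := by
  rw [← Complex.normSq_eq_norm_sq, Complex.normSq_apply]
  simp [pow_two]
  ring

/-- Equivalently, (1 - z²)/(1 - 2cz + z²) has positive real part; for the extremal functions, 1 +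
zf''/f' is α plus 1 - α times this quotient. -/
theorem re_one_sub_sq_mul_conj_pos {c : ℝ} (hc : |c| ≤ 1) {z : ℂ} (hz : z ∈ unitDisk) :
    0 < ((1 - z ^ 2) * conj (1 - 2 * c * z + z ^ 2)).re := by
  have hz := mem_unitDisk_iff.1 hz
  rw [re_one_sub_sq_mul_conj]
  have h1 : c * z.re ≤ ‖z‖ := by
    refine (le_abs_self _).trans ?_
    rw [abs_mul]
    nlinarith [Complex.abs_re_le_norm z, abs_nonneg c, abs_nonneg z.re, norm_nonneg z]
  apply mul_pos
  · nlinarith [norm_nonneg z]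
  · nlinarith [sq_nonneg (1 - ‖z‖)]

theorem one_sub_add_sq_ne_zero {c : ℝ} (hc : |c| ≤ 1) {z : ℂ} (hz : z ∈ unitDisk) :
    1 - 2 * (c : ℂ) * z + z ^ 2 ≠ 0 := by
  intro h
  have := re_one_sub_sq_mul_conj_pos hc hz
  simp [h] at this

/-- The function in `classF α` with derivative `(1 - 2 c z + z²) ^ (-(1 - α))`. -/
theorem exists_mem_classF_logDeriv_deriv_eq {α c : ℝ} (hα : α < 1) (hc : |c| ≤ 1) :
    ∃ f ∈ classF α, ∀ z ∈ unitDisk,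
      logDeriv (deriv f) z = 2 * (1 - α) * (c - z) / (1 - 2 * c * z + z ^ 2) := by
  have hTd : DifferentiableOn ℂ
      (fun z : ℂ => 2 * (1 - α) * (c - z) / (1 - 2 * c * z + z ^ 2)) unitDisk := by
    refine DifferentiableOn.div (by fun_prop) (by fun_prop) fun z hz => one_sub_add_sq_ne_zero hc hz
  obtain ⟨P, hP0, hP⟩ := hTd.isExactOn_ball.with_val_at 0 0
  have hPd : DifferentiableOn ℂ (fun z => Complex.exp (P z)) unitDisk := fun z hz =>
    (hP z hz).cexp.differentiableAt.differentiableWithinAt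
  obtain ⟨f, hf0, hf⟩ := hPd.isExactOn_ball.with_val_at 0 0
  have h0 : (0 : ℂ) ∈ unitDisk := by simp [unitDisk]
  have hder : ∀ z ∈ unitDisk, deriv f z = Complex.exp (P z) := fun z hz => (hf z hz).deriv
  have hder2 : ∀ z ∈ unitDisk, deriv (deriv f) z
      = Complex.exp (P z) * (2 * (1 - α) * (c - z) / (1 - 2 * c * z + z ^ 2)) := fun z hz => by
    have : deriv f =ᶠ[𝓝 z] fun z => Complex.exp (P z) := by
      filter_upwards [isOpen_unitDisk.mem_nhds hz] with w hw using hder w hw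
    rw [this.deriv_eq, (hP z hz).cexp.deriv]
  have hlog : ∀ z ∈ unitDisk,
      deriv (deriv f) z / deriv f z = 2 * (1 - α) * (c - z) / (1 - 2 * c * z + z ^ 2) := by
    intro z hz
    rw [hder2 z hz, hder z hz, mul_div_cancel_left₀ _ (Complex.exp_ne_zero _)]
  refine ⟨f, ⟨⟨fun z hz => (hf z hz).differentiableAt.differentiableWithinAt, hf0, ?_⟩,
    fun z hz => ?_, fun z hz => ?_⟩, hlog⟩
  · rw [hder 0 h0, hP0, Complex.exp_zero]
  · rw [hder z hz]; exact Complex.exp_ne_zero _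
  · have hq := one_sub_add_sq_ne_zero hc hz
    rw [mul_div_assoc, hlog z hz]
    have e : 1 + z * (2 * (1 - α) * (c - z) / (1 - 2 * c * z + z ^ 2))
        = (α : ℂ) + ((1 - α : ℝ) : ℂ) * ((1 - z ^ 2) / (1 - 2 * c * z + z ^ 2)) := by
      push_cast
      rw [mul_div_assoc', mul_div_assoc', add_comm (1 : ℂ), add_comm (α : ℂ), div_add' _ _ _ hq,
        div_add' _ _ _ hq]
      congr 1
      ring
    have h2 : 0 < ((1 - z ^ 2) / (1 - 2 * c * z + z ^ 2)).re := by
      have : (1 - z ^ 2) / (1 - 2 * c * z + z ^ 2) = (1 - z ^ 2) * conj (1 - 2 * c * z + z ^ 2)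
          * (((Complex.normSq (1 - 2 * c * z + z ^ 2))⁻¹ : ℝ) : ℂ) := by
        rw [div_eq_mul_inv, Complex.inv_def, ← mul_assoc]
      rw [this, Complex.re_mul_ofReal]
      exact mul_pos (re_one_sub_sq_mul_conj_pos hc hz) (inv_pos.2 (Complex.normSq_pos.2 hq))
    rw [e, Complex.add_re, Complex.re_ofReal_mul, Complex.ofReal_re]
    have := mul_pos (sub_pos.2 hα) h2
    linarith

theorem schwarzian_eq_of_logDeriv_deriv_eq {f : ℂ → ℂ} {α c : ℝ} (hc : |c| ≤ 1)
    (hf : ∀ z ∈ unitDisk,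
      logDeriv (deriv f) z = 2 * (1 - α) * (c - z) / (1 - 2 * c * z + z ^ 2))
    {z : ℂ} (hz : z ∈ unitDisk) :
    schwarzian f z = -(2 * (1 - α) * ((1 - c ^ 2) - α * (c - z) ^ 2))
      / (1 - 2 * c * z + z ^ 2) ^ 2 := by
  have hq := one_sub_add_sq_ne_zero hc hz
  have h1 : logDeriv (deriv f) =ᶠ[𝓝 z]
      fun z => 2 * (1 - α) * (c - z) / (1 - 2 * c * z + z ^ 2) := by
    filter_upwards [isOpen_unitDisk.mem_nhds hz] with w hw using hf w hw
  have hn : HasDerivAt (fun z : ℂ => 2 * (1 - (α : ℂ)) * (c - z)) (2 * (1 - α) * (-1)) z :=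
    ((hasDerivAt_id' z).const_sub _).const_mul _
  have hd : HasDerivAt (fun z : ℂ => 1 - 2 * (c : ℂ) * z + z ^ 2) (-(2 * c * 1) + 2 * z) z := by
    have := (((hasDerivAt_id' z).const_mul (2 * (c : ℂ))).const_sub 1).fun_add
      (hasDerivAt_pow 2 z)
    simpa using this
  rw [schwarzian, h1.deriv_eq, (hn.fun_div hd hq).deriv, hf z hz]
  field_simp
  ring

/-- The bound of the Schwarzian norm is approached on the real axis. -/
theorem exists_schwarzian_near_extremal {α η : ℝ} (hα : -1 / 2 ≤ α) (hα' : α < 0)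
    (hη : η < (1 - α) / (1 + α)) :
    ∃ f ∈ classF α, ∃ r : ℝ, ‖(r : ℂ)‖ < 1 ∧ ∃ m : ℝ, η < m ∧
      schwarzian f r / 2 * (1 - (r : ℂ) ^ 2) ^ 2 = -m := by
  -- `v` is the ratio Y/X at which the square discarded in `schwarzian_bound_aux` vanishes. The
  -- condition v ≤ 1 is exactly α ≥ -1/2.
  set v : ℝ := -α / (1 + α) with hv
  have h1α : 0 < 1 + α := by linarith
  have hv0 : 0 < v := div_pos (by linarith) h1α
  have hv1 : v ≤ 1 := by rw [hv, div_le_one h1α]; linarith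
  have hcont : ContinuousAt (fun r : ℝ => (1 - α) * (1 - v ^ 2 - α * (r + v) ^ 2)) 1 := by fun_prop
  have hval : (1 - α) * (1 - v ^ 2 - α * (1 + v) ^ 2) = (1 - α) / (1 + α) := by
    rw [hv]; field_simp; ring
  have hev : ∀ᶠ r : ℝ in 𝓝[<] 1, η < (1 - α) * (1 - v ^ 2 - α * (r + v) ^ 2) :=
    (hcont.eventually (lt_mem_nhds (hη.trans_eq hval.symm))).filter_mono nhdsWithin_le_nhds
  obtain ⟨r, hr, hr0, hr1⟩ := (hev.and (Ioo_mem_nhdsLT (zero_lt_one' ℝ))).exists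
  have hden : 0 < 1 + r ^ 2 + 2 * r * v := by positivity
  -- For these functions φ(z) = (c - z)/(1 - cz), and `c` is chosen so that s = φ(r) satisfies (s -
  -- r)/(1 - rs) = v. The remaining loss, r ≤ 1, disappears as r → 1.
  set c : ℝ := (2 * r + v * (1 + r ^ 2)) / (1 + r ^ 2 + 2 * r * v) with hc
  have hc0 : 0 ≤ c := by positivity
  have hc1 : c ≤ 1 := by
    rw [hc, div_le_one hden]
    nlinarith [mul_nonneg (sub_nonneg.2 hv1) (sq_nonneg (1 - r))]
  have hcabs : |c| ≤ 1 := by rwa [abs_of_nonneg hc0]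
  obtain ⟨f, hf, hlog⟩ := exists_mem_classF_logDeriv_deriv_eq (by linarith : α < 1) hcabs
  have hrn : ‖(r : ℂ)‖ < 1 := by rwa [Complex.norm_real, Real.norm_of_nonneg hr0.le]
  have hrD : (r : ℂ) ∈ unitDisk := mem_unitDisk_iff.2 hrn
  refine ⟨f, hf, r, hrn, _, hr, ?_⟩
  have hq : 1 - 2 * c * r + r ^ 2 ≠ 0 := by
    have := one_sub_add_sq_ne_zero hcabs hrD
    exact_mod_cast this
  rw [schwarzian_eq_of_logDeriv_deriv_eq hcabs hlog hrD]
  have hreal : -(2 * (1 - α) * ((1 - c ^ 2) - α * (c - r) ^ 2)) / (1 - 2 * c * r + r ^ 2) ^ 2 / 2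
      * (1 - r ^ 2) ^ 2 = -((1 - α) * (1 - v ^ 2 - α * (r + v) ^ 2)) := by
    have hr2 : 0 < 1 - r ^ 2 := by nlinarith
    have e1 : 1 - 2 * c * r + r ^ 2 = (1 - r ^ 2) ^ 2 / (1 + r ^ 2 + 2 * r * v) := by
      rw [hc]; field_simp; ring
    have e2 : 1 - c ^ 2 = (1 - r ^ 2) ^ 2 * (1 - v ^ 2) / (1 + r ^ 2 + 2 * r * v) ^ 2 := by
      rw [hc]; field_simp; ring
    have e3 : c - r = (1 - r ^ 2) * (r + v) / (1 + r ^ 2 + 2 * r * v) := by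
      rw [hc]; field_simp; ring
    rw [e1, e2, e3]
    field_simp
  exact_mod_cast hreal

/-- Along the geodesic in direction `ζ` from a point `r` of the real axis, the two-point distortion
is given near `r` by a solution of `v'' = c v` with `c 0 = 1 + m ζ²`. -/
theorem exists_solution_near_extremal {α η ε : ℝ} (hα : -1 / 2 ≤ α) (hα' : α < 0)
    (hη : η < (1 - α) / (1 + α)) {ζ : ℂ} {τ : ℝ} (hζ : ‖ζ‖ = 1) (hτ : ζ ^ 2 = τ) (hε : 0 < ε) :
    ∃ f ∈ classF α, ∃ r : ℝ, ‖(r : ℂ)‖ < 1 ∧ ∃ m : ℝ, η < m ∧ ∃ v v' c : ℝ → ℂ,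
      (∀ t, HasDerivAt v (v' t) t) ∧ (∀ t, HasDerivAt v' (c t * v t) t) ∧ v 0 = 0 ∧ v' 0 ≠ 0 ∧
      ContinuousAt c 0 ∧ c 0 = ((1 + m * τ : ℝ) : ℂ) ∧
      ∀ᶠ t in 𝓝[>] 0, ∃ z ∈ unitDisk, hypDist r z = t ∧ t < ε ∧
        twoPointDistortion f r z = ‖v t‖ / ‖v' 0‖ := by
  obtain ⟨f, hf, r, hr, m, hm, hS⟩ := exists_schwarzian_near_extremal hα hα' hη
  obtain ⟨v, v', hv, hv', h0, hne, hΔ⟩ := exists_solution_twoPointDistortion hf.1.1 hf.2.1 hr hζ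
  refine ⟨f, hf, r, hr, m, hm, v, v', _, hv, hv', h0, hne, ?_, ?_, ?_⟩
  · have h1 : ContinuousAt (schwarzian f) (hypGeodesic r ζ 0) :=
      ((differentiableOn_schwarzian hf.1.1 hf.2.1).differentiableAt
        (isOpen_unitDisk.mem_nhds (hypGeodesic_mem_unitDisk hr hζ 0))).continuousAt
    have h2 : ContinuousAt (fun t => schwarzian f (hypGeodesic r ζ t)) 0 :=
      ContinuousAt.comp (f := hypGeodesic r ζ) h1 (hasDerivAt_hypGeodesic hr hζ 0).continuousAt
    have h3 : ContinuousAt (hypVelocity r ζ) 0 :=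
      continuousAt_const.div ((hasDerivAt_hypGeodesicDen r ζ 0).continuousAt.pow 2)
        (pow_ne_zero 2 (hypGeodesicDen_ne_zero hr hζ 0))
    exact continuousAt_const.sub ((h2.div_const 2).mul (h3.pow 2))
  · rw [hypGeodesic_zero, hypVelocity, hypGeodesicDen_zero, one_pow, div_one, mul_pow, hτ,
      Complex.conj_ofReal]
    push_cast
    linear_combination (-(τ : ℂ)) * hS
  · filter_upwards [Ioo_mem_nhdsGT hε] with t ht
    exact ⟨_, hypGeodesic_mem_unitDisk hr hζ t, hypDist_hypGeodesic hr hζ ht.1.le, ht.2, (hΔ t).symm⟩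

/-! ### The two bounds and their sharpness. -/

theorem hasDerivAt_sin_const_mul (δ t : ℝ) :
    HasDerivAt (fun t => Real.sin (δ * t)) (δ * Real.cos (δ * t)) t := by
  simpa [mul_comm] using ((hasDerivAt_id t).const_mul δ).sin

theorem hasDerivAt_cos_const_mul (δ t : ℝ) :
    HasDerivAt (fun t => δ * Real.cos (δ * t)) (-δ ^ 2 * Real.sin (δ * t)) t := by
  refine ((((hasDerivAt_id t).const_mul δ).cos).const_mul δ).congr_deriv ?_
  simp; ring

theorem hasDerivAt_sinh_const_mul (κ t : ℝ) :
    HasDerivAt (fun t => Real.sinh (κ * t)) (κ * Real.cosh (κ * t)) t := by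
  simpa [mul_comm] using ((hasDerivAt_id t).const_mul κ).sinh

theorem hasDerivAt_cosh_const_mul (κ t : ℝ) :
    HasDerivAt (fun t => κ * Real.cosh (κ * t)) (κ ^ 2 * Real.sinh (κ * t)) t := by
  refine ((((hasDerivAt_id t).const_mul κ).cosh).const_mul κ).congr_deriv ?_
  simp; ring

/-- The lower and upper bounds for the two-point distortion on `classF α`. -/
theorem twoPointDistortion_bounds {α : ℝ} (hα : -1 < α) (hα' : α < 0) {f : ℂ → ℂ}
    (hf : f ∈ classF α) {z₁ z₂ : ℂ} (hz₁ : z₁ ∈ unitDisk) (hz₂ : z₂ ∈ unitDisk) :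
    (hypDist z₁ z₂ ≤ Real.pi * √((1 + α) / (-2 * α)) →
        √((1 + α) / (-2 * α)) * Real.sin (√(-2 * α / (1 + α)) * hypDist z₁ z₂)
          ≤ twoPointDistortion f z₁ z₂) ∧
      twoPointDistortion f z₁ z₂
        ≤ √((1 + α) / 2) * Real.sinh (√(2 / (1 + α)) * hypDist z₁ z₂) := by
  have h1α : 0 < 1 + α := by linarith
  have hz := mem_unitDisk_iff.1 hz₁
  obtain ⟨ζ, hζ, L, hL, rfl⟩ := exists_hypGeodesic_eq hz (mem_unitDisk_iff.1 hz₂)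
  obtain ⟨v, v', hv, hv', h0, hne, hΔ⟩ := exists_solution_twoPointDistortion hf.1.1 hf.2.1 hz hζ
  have hpos := norm_pos_iff.2 hne
  have hq : ∀ t, ‖schwarzian f (hypGeodesic z₁ ζ t) / 2 * hypVelocity z₁ ζ t ^ 2‖
      ≤ (1 - α) / (1 + α) := by
    intro t
    have := norm_schwarzian_le hα hα'.le hf (hypGeodesic_mem_unitDisk hz hζ t)
    rw [norm_mul, norm_pow, norm_hypVelocity hz hζ, norm_div, Complex.norm_ofNat]
    linarith
  rw [hypDist_hypGeodesic hz hζ hL, ← hΔ L]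
  constructor
  · intro hLle
    set δ := √(-2 * α / (1 + α)) with hδ
    have hδsq : δ ^ 2 = -2 * α / (1 + α) := Real.sq_sqrt (div_nonneg (by linarith) h1α.le)
    have hδ0 : 0 < δ := Real.sqrt_pos.2 (div_pos (by linarith) h1α)
    have hinv : √((1 + α) / (-2 * α)) = δ⁻¹ := by rw [hδ, ← Real.sqrt_inv, inv_div]
    rw [hinv] at hLle ⊢
    rw [← div_eq_mul_inv, le_div_iff₀ hδ0, mul_comm] at hLle
    rcases hL.eq_or_lt with rfl | hL0
    · simp [h0]
    -- At δL = π the lower bound is 0; below π the sine is positive on all of (0, L], as Sturm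
    -- comparison requires.
    rcases hLle.eq_or_lt with hLe | hLlt
    · rw [hLe, Real.sin_pi, mul_zero]; positivity
    have hsturm := sturm_norm_ge hv hv' h0 (s := fun t => Real.sin (δ * t) / δ)
      (s' := fun t => δ * Real.cos (δ * t) / δ) (k := -δ ^ 2)
      (fun t => (hasDerivAt_sin_const_mul δ t).div_const δ)
      (fun t => ((hasDerivAt_cos_const_mul δ t).div_const δ).congr_deriv (by ring)) (by simp)
      (by simp [hδ0.ne']) (fun t => ?_) hL0 (fun t ht => ?_)
    · rw [le_div_iff₀ hpos]
      refine le_of_eq_of_le ?_ hsturm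
      ring
    · have h1 := (Complex.re_le_norm _).trans (hq t)
      rw [Complex.sub_re, Complex.one_re, hδsq]
      have : -(-2 * α / (1 + α)) = 1 - (1 - α) / (1 + α) := by field_simp; ring
      linarith
    · refine div_pos (Real.sin_pos_of_pos_of_lt_pi (mul_pos hδ0 ht.1) ?_) hδ0
      exact (mul_le_mul_of_nonneg_left ht.2 hδ0.le).trans_lt hLlt
  · set κ := √(2 / (1 + α)) with hκ
    have hκsq : κ ^ 2 = 2 / (1 + α) := Real.sq_sqrt (by positivity)
    have hκ0 : 0 < κ := Real.sqrt_pos.2 (by positivity)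
    have hinv : √((1 + α) / 2) = κ⁻¹ := by rw [hκ, ← Real.sqrt_inv, inv_div]
    rw [hinv, div_le_iff₀ hpos]
    refine (norm_le_sinh_of_norm_coeff_le hκ0 hv hv' h0 (fun t => ?_) hL).trans_eq (by ring)
    refine (norm_sub_le _ _).trans ?_
    rw [norm_one, hκsq]
    have : 2 / (1 + α) = 1 + (1 - α) / (1 + α) := by field_simp; ring
    linarith [hq t]

/-- The imaginary direction gives ζ² = -1, so the coefficient at 0 is 1 - m, which lies below -δ²
once m > 1 + δ². -/
theorem exists_twoPointDistortion_lt_sin {α δ ε : ℝ} (hα : -1 / 2 ≤ α) (hα' : α < 0)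
    (hδ : 0 < δ) (hδ' : δ < √(-2 * α / (1 + α))) (hε : 0 < ε) :
    ∃ f ∈ classF α, ∃ z₁ ∈ unitDisk, ∃ z₂ ∈ unitDisk, hypDist z₁ z₂ < ε ∧
      twoPointDistortion f z₁ z₂ < 1 / δ * Real.sin (δ * hypDist z₁ z₂) := by
  have h1α : 0 < 1 + α := by linarith
  have hη : 1 + δ ^ 2 < (1 - α) / (1 + α) := by
    have h := (Real.lt_sqrt hδ.le).1 hδ'
    have : (1 - α) / (1 + α) = 1 + -2 * α / (1 + α) := by field_simp; ring
    linarith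
  obtain ⟨f, hf, r, hr, m, hm, v, v', c, hv, hv', h0, hne, hc, hc0, hev⟩ :=
    exists_solution_near_extremal hα hα' hη (ζ := Complex.I) (τ := -1) (by simp) (by simp) hε
  have hcomp := eventually_norm_lt_of_coeff_lt hv hv' h0 hc hc0 hne
    (s := fun t => (Real.sin (δ * t) : ℂ)) (s' := fun t => ((δ * Real.cos (δ * t) : ℝ) : ℂ))
    (d := fun _ => ((-δ ^ 2 : ℝ) : ℂ)) (l := -δ ^ 2)
    (fun t => (hasDerivAt_sin_const_mul δ t).ofReal_comp)
    (fun t => (hasDerivAt_cos_const_mul δ t).ofReal_comp.congr_deriv (by push_cast; rfl)) (by simp)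
    continuousAt_const rfl (by simp [hδ.ne']) (by linarith)
  -- Requiring t < π/δ keeps sin(δt) positive, so it equals its norm.
  obtain ⟨t, ⟨ht, z, hz, hd, htε, hΔ⟩, ht0, htπ⟩ := ((hcomp.and hev).and
    (Ioo_mem_nhdsGT (div_pos Real.pi_pos hδ))).exists
  refine ⟨f, hf, r, mem_unitDisk_iff.2 hr, z, hz, hd ▸ htε, ?_⟩
  rw [hd, hΔ]
  refine ht.trans_eq ?_
  have hsin : 0 < Real.sin (δ * t) := by
    refine Real.sin_pos_of_pos_of_lt_pi (mul_pos hδ ht0) ?_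
    rwa [lt_div_iff₀ hδ, mul_comm] at htπ
  rw [Complex.norm_real, Complex.norm_real, Real.norm_of_nonneg hsin.le, mul_zero, Real.cos_zero,
    mul_one, Real.norm_of_nonneg hδ.le]
  ring

/-- The real direction gives ζ² = 1 and the coefficient 1 + m at 0, which exceeds κ² once m > κ² -
1. -/
theorem exists_sinh_lt_twoPointDistortion {α κ ε : ℝ} (hα : -1 / 2 ≤ α) (hα' : α < 0)
    (hκ : 0 < κ) (hκ' : κ < √(2 / (1 + α))) (hε : 0 < ε) :
    ∃ f ∈ classF α, ∃ z₁ ∈ unitDisk, ∃ z₂ ∈ unitDisk, hypDist z₁ z₂ < ε ∧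
      1 / κ * Real.sinh (κ * hypDist z₁ z₂) < twoPointDistortion f z₁ z₂ := by
  have h1α : 0 < 1 + α := by linarith
  have hη : κ ^ 2 - 1 < (1 - α) / (1 + α) := by
    have h := (Real.lt_sqrt hκ.le).1 hκ'
    have : (1 - α) / (1 + α) = 2 / (1 + α) - 1 := by field_simp; ring
    linarith
  obtain ⟨f, hf, r, hr, m, hm, v, v', c, hv, hv', h0, hne, hc, hc0, hev⟩ :=
    exists_solution_near_extremal hα hα' hη (ζ := 1) (τ := 1) (by simp) (by simp) hε
  have hcomp := eventually_norm_lt_of_coeff_lt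
    (v := fun t => (Real.sinh (κ * t) : ℂ)) (v' := fun t => ((κ * Real.cosh (κ * t) : ℝ) : ℂ))
    (c := fun _ => ((κ ^ 2 : ℝ) : ℂ)) (k := κ ^ 2)
    (fun t => (hasDerivAt_sinh_const_mul κ t).ofReal_comp)
    (fun t => (hasDerivAt_cosh_const_mul κ t).ofReal_comp.congr_deriv (by push_cast; rfl)) (by simp)
    continuousAt_const rfl (by simp [hκ.ne']) hv hv' h0 hc hc0 hne (by linarith)
  obtain ⟨t, ⟨ht, z, hz, hd, htε, hΔ⟩, ht0⟩ := ((hcomp.and hev).and self_mem_nhdsWithin).exists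
  have ht0 : 0 < t := ht0
  refine ⟨f, hf, r, mem_unitDisk_iff.2 hr, z, hz, hd ▸ htε, ?_⟩
  rw [hd, hΔ]
  refine lt_of_eq_of_lt ?_ ht
  have hsinh : 0 < Real.sinh (κ * t) := Real.sinh_pos_iff.2 (mul_pos hκ ht0)
  rw [Complex.norm_real, Complex.norm_real, Real.norm_of_nonneg hsinh.le, mul_zero, Real.cosh_zero,
    mul_one, Real.norm_of_nonneg hκ.le]
  ring

theorem mainTheorem6 (α : ℝ) (hα : -1 / 2 ≤ α) (hα' : α < 0) :
    (∀ f ∈ classF α, ∀ z₁ ∈ unitDisk, ∀ z₂ ∈ unitDisk,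
      (hypDist z₁ z₂ ≤ Real.pi * √((1 + α) / (-2 * α)) →
        √((1 + α) / (-2 * α)) * Real.sin (√(-2 * α / (1 + α)) * hypDist z₁ z₂)
          ≤ twoPointDistortion f z₁ z₂) ∧
      twoPointDistortion f z₁ z₂
        ≤ √((1 + α) / 2) * Real.sinh (√(2 / (1 + α)) * hypDist z₁ z₂)) ∧
    (∀ δ : ℝ, 0 < δ → δ < √(-2 * α / (1 + α)) → ∀ ε : ℝ, 0 < ε →
      ∃ f ∈ classF α, ∃ z₁ ∈ unitDisk, ∃ z₂ ∈ unitDisk, hypDist z₁ z₂ < ε ∧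
        twoPointDistortion f z₁ z₂ < 1 / δ * Real.sin (δ * hypDist z₁ z₂)) ∧
    (∀ κ : ℝ, 0 < κ → κ < √(2 / (1 + α)) → ∀ ε : ℝ, 0 < ε →
      ∃ f ∈ classF α, ∃ z₁ ∈ unitDisk, ∃ z₂ ∈ unitDisk, hypDist z₁ z₂ < ε ∧
        1 / κ * Real.sinh (κ * hypDist z₁ z₂) < twoPointDistortion f z₁ z₂) := by
  exact ⟨fun f hf z₁ hz₁ z₂ hz₂ => twoPointDistortion_bounds (by linarith) hα' hf hz₁ hz₂,
    fun δ hδ hδ' ε hε => exists_twoPointDistortion_lt_sin hα hα' hδ hδ' hε,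
    fun κ hκ hκ' ε hε => exists_sinh_lt_twoPointDistortion hα hα' hκ hκ' hε⟩
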